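/- Let $\Bbbk$ be an algebraically closed field of characteristic zero, and let $\mathbb X\subseteq\mathbb P^2_{\Bbbk}$ be the standard $\Bbbk$-configuration of type $(2,3,4)$, i.e. the set of nine points $$[1:0:2],\ [1:1:2],\quad [1:0:1],\ [1:1:1],\ [1:2:1],\quad [1:0:0],\ [1:1:0],\ [1:2:0],\ [1:3:0].$$ Let $I_{\mathbb X}\subseteq R=\Bbbk[x_0,x_1,x_2]$ be the homogeneous ideal of $\mathbb X$ (generated by all forms vanishing at every point of $\mathbb X$), let $I_{\mathbb X}^{(t)}=\bigcap_{P\in\operatorname{Ass}(R/I_{\mathbb X})}\bigl(I_{\mathbb X}^tR_P\cap R\bigr)$ be its $t$-th symbolic power, and for a nonzero homogeneous ideal $J\subseteq R$ let $\alpha(J)$ be the least degree of a nonzero form in $J$. Then the Waldschmidt constant of $\mathbb X$ is $17/6$; that is, the following limit exists and $$\widehat\alpha(I_{\mathbb X})=\lim_{t\to\infty}\frac{\alpha\bigl(I_{\mathbb X}^{(t)}\bigr)}{t}=\frac{17}{6}.$$ -/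

import Mathlib

/-- The `t`-th symbolic power `⋂_{P ∈ Ass(R/I)} (I ^ t R_P ∩ R)` of an ideal `I` of `R`. -/
def symbolicPower {R : Type*} [CommRing R] (I : Ideal R) (t : ℕ) : Ideal R :=
  ⨅ P : associatedPrimes R (R ⧸ I),
    ((I ^ t).map (algebraMap R (Localization.AtPrime P.1))).comap
      (algebraMap R (Localization.AtPrime P.1))

/-- The initial degree `α(I)` of a homogeneous ideal `I` of a polynomial ring: the least degree
of a nonzero form in `I`. -/
noncomputable def initialDegree {σ k : Type*} [Field k] (I : Ideal (MvPolynomial σ k)) : ℕ :=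
  sInf {d : ℕ | ∃ f : MvPolynomial σ k, f ∈ I ∧ f ≠ 0 ∧ f.IsHomogeneous d}

/-- The limit defining the Waldschmidt constant of `I` exists and is equal to `c`. -/
def HasWaldschmidtConstant {σ k : Type*} [Field k] (I : Ideal (MvPolynomial σ k)) (c : ℝ) :
    Prop :=
  Filter.Tendsto (fun t : ℕ => (initialDegree (symbolicPower I t) : ℝ) / (t : ℝ))
    Filter.atTop (nhds c)

/-- The homogeneous ideal `I_X` of a set `X` of points of projective space: the ideal generated by
all forms which vanish at every point of `X`. -/
noncomputable def projectiveVanishingIdeal {σ k : Type*} [Field k] (X : Set (Projectivization k (σ → k))) :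
    Ideal (MvPolynomial σ k) :=
  Ideal.span {f | (∃ d : ℕ, f.IsHomogeneous d) ∧ ∀ p ∈ X, MvPolynomial.eval p.rep f = 0}

/-- The point `[1 : a : b]` of the projective plane. -/
def planePoint {k : Type*} [Field k] (a b : k) : Projectivization k (Fin 3 → k) :=
  Projectivization.mk k ![1, a, b] (fun h => one_ne_zero (congrFun h 0))

/-- `X` is the standard `k`-configuration of type `(d₁, …, dₛ)`: the type satisfies
`1 ≤ d₁ < ⋯ < dₛ`, and `X` consists of the points `[1 : j : s - i]` with `1 ≤ i ≤ s` and
`0 ≤ j ≤ dᵢ - 1`. Here `i : Fin s` counts from `0`, so that `s - 1 - i`, which is `i.rev`, takes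
the place of `s - i`. -/
def IsStandardKConfiguration {k : Type*} [Field k] {s : ℕ} (d : Fin s → ℕ)
    (X : Set (Projectivization k (Fin 3 → k))) : Prop :=
  (∀ i, 1 ≤ d i) ∧ StrictMono d ∧
    X = {p | ∃ i : Fin s, ∃ j : ℕ, j < d i ∧ p = planePoint (j : k) ((i.rev : ℕ) : k)}

open MvPolynomial

/-! Lower bound: let `f ≠ 0` vanish to order `m_b` at the `4 - b` points of the row `x₂ = b x₀`, for
`b = 0, 1, 2`. If no row divides `f`, restriction to the rows gives `deg f ≥ 4m₀, 3m₁, 2m₂`. Since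
`6/4 + 6/3 + 5/2 = 6`, it follows that `6m₀ + 6m₁ + 5m₂ ≤ 6 deg f`. As no weight exceeds 6, this
inequality survives multiplication by a row, so induction on the degree proves it in general
(`le_totalDegree_of_X_pow_dvd_pointExpansion`). With every `m_b = t` it reads `17t ≤ 6 deg f`.

Upper bound: an explicit product of lines and a conic has degree 17 and multiplicity at least 6 at
all nine points (`extremalForm_mem_pow`); its powers give `α ≤ 17⌈t/6⌉`.

Two facts about the symbolic power suffice: it contains `⋂ Pᵢ ^ t`, and its elements vanish to order
`t` at each point. -/

/-! ### Symbolic powers of a finite intersection of incomparable primes -/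

theorem mem_colon_bot_singleton_mk {R : Type*} [CommRing R] (I : Ideal R) (x r : R) :
    r ∈ Submodule.colon (⊥ : Submodule R (R ⧸ I)) {Ideal.Quotient.mk I x} ↔ r * x ∈ I := by
  rw [Submodule.mem_colon_singleton, Submodule.mem_bot, ← Ideal.Quotient.eq_zero_iff_mem, map_mul]
  rfl

theorem exists_mem_iInf_ne_notMem {R ι : Type*} [CommRing R] [Finite ι] {P : ι → Ideal R}
    (hP : ∀ i, (P i).IsPrime) (hinc : ∀ i j, P j ≤ P i → j = i) (i : ι) :
    ∃ x ∉ P i, ∀ j, j ≠ i → x ∈ P j := by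
  classical
  cases nonempty_fintype ι
  by_contra! h
  have hle : (Finset.univ.erase i).inf P ≤ P i := by
    intro x hx
    by_contra hxi
    obtain ⟨j, hji, hj⟩ := h x hxi
    exact hj (Finset.inf_le (f := P) (Finset.mem_erase.2 ⟨hji, Finset.mem_univ j⟩) hx)
  obtain ⟨j, hj, hji⟩ := (hP i).inf_le'.1 hle
  exact Finset.ne_of_mem_erase hj (hinc i j hji)

/-- The annihilator of the class of `x` is the intersection of the `P i` not containing `x`; if it
is prime, it is one of them. -/
theorem associatedPrimes_quotient_iInf {R ι : Type*} [CommRing R] [IsNoetherianRing R] [Finite ι]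
    {P : ι → Ideal R} (hP : ∀ i, (P i).IsPrime) (hinc : ∀ i j, P j ≤ P i → j = i) :
    associatedPrimes R (R ⧸ ⨅ i, P i) = Set.range P := by
  classical
  cases nonempty_fintype ι
  ext J
  rw [AssociatedPrimes.mem_iff, isAssociatedPrime_iff, Set.mem_range]
  constructor
  · rintro ⟨hJ, y, hy⟩
    obtain ⟨x, rfl⟩ := Ideal.Quotient.mk_surjective y
    have hmem : ∀ r, r ∈ J ↔ ∀ i, r * x ∈ P i := fun r => by
      rw [hy, mem_colon_bot_singleton_mk, Ideal.mem_iInf]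
    have hle : (Finset.univ.filter fun i => x ∉ P i).inf P ≤ J := by
      intro r hr
      refine (hmem r).2 fun i => ?_
      by_cases hx : x ∈ P i
      · exact (P i).mul_mem_left r hx
      · exact (P i).mul_mem_right x
          (Finset.inf_le (f := P) (Finset.mem_filter.2 ⟨Finset.mem_univ i, hx⟩) hr)
    obtain ⟨i, hi, hiJ⟩ := hJ.inf_le'.1 hle
    refine ⟨i, le_antisymm hiJ fun r hr => ?_⟩
    exact ((hP i).mem_or_mem ((hmem r).1 hr i)).resolve_right (Finset.mem_filter.1 hi).2
  · rintro ⟨i, rfl⟩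
    obtain ⟨x, hxi, hx⟩ := exists_mem_iInf_ne_notMem hP hinc i
    refine ⟨hP i, Ideal.Quotient.mk _ x, ?_⟩
    ext r
    rw [mem_colon_bot_singleton_mk, Ideal.mem_iInf]
    refine ⟨fun hr j => ?_, fun hr => ((hP i).mem_or_mem (hr i)).resolve_right hxi⟩
    by_cases hj : j = i
    · exact hj ▸ (P i).mul_mem_right x hr
    · exact (P j).mul_mem_left r (hx j hj)

theorem mem_symbolicPower_iff {R : Type*} [CommRing R] (I : Ideal R) (t : ℕ) (f : R) :
    f ∈ symbolicPower I t ↔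
      ∀ P ∈ associatedPrimes R (R ⧸ I), ∃ s ∉ P, s * f ∈ I ^ t := by
  have key : ∀ P : associatedPrimes R (R ⧸ I),
      (f ∈ ((I ^ t).map (algebraMap R (Localization.AtPrime P.1))).comap
        (algebraMap R (Localization.AtPrime P.1))) ↔ ∃ s ∉ P.1, s * f ∈ I ^ t := by
    intro P
    rw [Ideal.mem_comap, IsLocalization.algebraMap_mem_map_algebraMap_iff P.1.primeCompl]
    simp only [Ideal.mem_primeCompl_iff]
  rw [symbolicPower, Ideal.mem_iInf]
  simp only [key, Subtype.forall]

/-- If `x ∉ P i` lies in all the other primes, then `x · P i ⊆ ⋂ P j`, so `x ^ t` serves as the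
denominator at `P i`. -/
theorem iInf_pow_le_symbolicPower_iInf {R ι : Type*} [CommRing R] [IsNoetherianRing R] [Finite ι]
    {P : ι → Ideal R} (hP : ∀ i, (P i).IsPrime) (hinc : ∀ i j, P j ≤ P i → j = i) (t : ℕ) :
    ⨅ i, P i ^ t ≤ symbolicPower (⨅ i, P i) t := by
  intro f hf
  rw [mem_symbolicPower_iff, associatedPrimes_quotient_iInf hP hinc]
  rintro _ ⟨i, rfl⟩
  obtain ⟨x, hxi, hx⟩ := exists_mem_iInf_ne_notMem hP hinc i
  refine ⟨x ^ t, fun h => hxi ((hP i).mem_of_pow_mem t h), ?_⟩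
  have hle : Ideal.span {x} * P i ≤ ⨅ i, P i := by
    refine le_iInf fun j => ?_
    by_cases hj : j = i
    · exact hj ▸ Ideal.mul_le_right
    · exact Ideal.mul_le_left.trans ((Ideal.span_singleton_le_iff_mem _).2 (hx j hj))
  have h := Ideal.pow_right_mono hle t
  rw [mul_pow, Ideal.span_singleton_pow] at h
  exact h (Ideal.mul_mem_mul (Ideal.mem_span_singleton_self _) ((Ideal.mem_iInf.1 hf) i))

/-! ### Ideals of projective points -/

/-- The restriction of a polynomial to the line through the origin spanned by `v`. -/
noncomputable def lineRestriction {σ k : Type*} [Field k] (v : σ → k) :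
    MvPolynomial σ k →ₐ[k] Polynomial k :=
  aeval fun i => Polynomial.C (v i) * Polynomial.X

/-- The ideal of the point of projective space with homogeneous coordinates `v`. -/
noncomputable def pointIdeal {σ k : Type*} [Field k] (v : σ → k) : Ideal (MvPolynomial σ k) :=
  RingHom.ker (lineRestriction v)

instance pointIdeal_isPrime {σ k : Type*} [Field k] (v : σ → k) : (pointIdeal v).IsPrime :=
  RingHom.ker_isPrime _

theorem lineRestriction_of_isHomogeneous {σ k : Type*} [Field k] (v : σ → k)
    {f : MvPolynomial σ k} {d : ℕ} (hf : f.IsHomogeneous d) :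
    lineRestriction v f = Polynomial.C (eval v f) * Polynomial.X ^ d := by
  rw [lineRestriction, aeval_def, eval₂_eq, eval_eq, map_sum, Finset.sum_mul]
  refine Finset.sum_congr rfl fun m hm => ?_
  have hd : ∑ i ∈ m.support, m i = d := by
    have := hf (mem_support_iff.1 hm)
    rwa [Finsupp.weight_apply, Finsupp.sum, Finset.sum_congr rfl fun i _ => by
      rw [Pi.one_apply, smul_eq_mul, mul_one]] at this
  simp only [mul_pow, Finset.prod_mul_distrib, Finset.prod_pow_eq_pow_sum, hd, map_mul, map_prod,
    map_pow, mul_assoc]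
  rfl

theorem mem_pointIdeal_of_isHomogeneous {σ k : Type*} [Field k] {v : σ → k}
    {f : MvPolynomial σ k} {d : ℕ} (hf : f.IsHomogeneous d) :
    f ∈ pointIdeal v ↔ eval v f = 0 := by
  rw [pointIdeal, RingHom.mem_ker, lineRestriction_of_isHomogeneous v hf, mul_eq_zero,
    Polynomial.C_eq_zero]
  exact or_iff_left (pow_ne_zero _ Polynomial.X_ne_zero)

theorem eval_smul_of_isHomogeneous {σ k : Type*} [Field k] (c : k) (v : σ → k)
    {f : MvPolynomial σ k} {d : ℕ} (hf : f.IsHomogeneous d) :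
    eval (c • v) f = c ^ d * eval v f := by
  have h : ((Polynomial.aeval c).comp (lineRestriction v)) f = aeval (c • v) f := by
    congr 1
    refine algHom_ext fun i => ?_
    rw [AlgHom.comp_apply, lineRestriction, aeval_X, aeval_X, map_mul, Polynomial.aeval_C,
      Polynomial.aeval_X, Pi.smul_apply, smul_eq_mul, mul_comm]
    rfl
  rw [AlgHom.comp_apply, lineRestriction_of_isHomogeneous v hf, map_mul, Polynomial.aeval_C,
    map_pow, Polynomial.aeval_X, aeval_eq_eval] at h
  rw [mul_comm]
  exact h.symm

theorem coeff_lineRestriction {σ k : Type*} [Field k] (v : σ → k) (f : MvPolynomial σ k) (d : ℕ) :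
    (lineRestriction v f).coeff d = eval v (homogeneousComponent d f) := by
  conv_lhs => rw [← sum_homogeneousComponent f, map_sum, Polynomial.finsetSum_coeff]
  rw [Finset.sum_congr rfl fun i _ => by
    rw [lineRestriction_of_isHomogeneous v (homogeneousComponent_isHomogeneous i f),
      Polynomial.coeff_C_mul_X_pow]]
  rw [Finset.sum_ite_eq]
  split_ifs with h
  · rfl
  · rw [homogeneousComponent_eq_zero _ _ (by simpa using h), map_zero]

theorem projectiveVanishingIdeal_eq_iInf {σ k : Type*} [Field k]
    (X : Set (Projectivization k (σ → k))) :
    projectiveVanishingIdeal X = ⨅ p : X, pointIdeal p.1.rep := by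
  apply le_antisymm
  · refine Ideal.span_le.2 ?_
    rintro f ⟨⟨d, hd⟩, hf⟩
    rw [SetLike.mem_coe, Ideal.mem_iInf]
    exact fun p => (mem_pointIdeal_of_isHomogeneous hd).2 (hf p.1 p.2)
  · intro f hf
    rw [← sum_homogeneousComponent f]
    refine Ideal.sum_mem _ fun i _ => Ideal.subset_span
      ⟨⟨i, homogeneousComponent_isHomogeneous i f⟩, fun p hp => ?_⟩
    have h : lineRestriction p.rep f = 0 := (Ideal.mem_iInf.1 hf) ⟨p, hp⟩
    rw [← coeff_lineRestriction, h, Polynomial.coeff_zero]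

/-- Frees the ideal from the arbitrary choice of coordinates made by `rep`. -/
theorem pointIdeal_smul {σ k : Type*} [Field k] {c : k} (hc : c ≠ 0) (v : σ → k) :
    pointIdeal (c • v) = pointIdeal v := by
  have hmem : ∀ (w : σ → k) (f : MvPolynomial σ k),
      f ∈ pointIdeal w ↔ ∀ d, eval w (homogeneousComponent d f) = 0 := fun w f => by
    rw [pointIdeal, RingHom.mem_ker, Polynomial.ext_iff]
    simp only [coeff_lineRestriction, Polynomial.coeff_zero]
  ext f
  simp only [hmem, eval_smul_of_isHomogeneous c v (homogeneousComponent_isHomogeneous _ f),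
    mul_eq_zero, pow_eq_zero_iff', hc, false_and, false_or]

theorem pointIdeal_rep_mk {σ k : Type*} [Field k] (v : σ → k) (hv : v ≠ 0) :
    pointIdeal (Projectivization.mk k v hv).rep = pointIdeal v := by
  obtain ⟨c, hc⟩ := Projectivization.exists_smul_eq_mk_rep k v hv
  rw [← hc]
  exact pointIdeal_smul c.ne_zero v

/-! ### Order of vanishing and restriction to rows -/

/-- The expansion of a polynomial around the point `[1 : a : b]`: the variable `T` of the
univariate polynomial ring measures the order of vanishing at that point. -/
noncomputable def pointExpansion {k : Type*} [Field k] (a b : k) :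
    MvPolynomial (Fin 3) k →ₐ[k] Polynomial (MvPolynomial (Fin 3) k) :=
  aeval ![Polynomial.C (X 0), Polynomial.C (C a * X 0) + Polynomial.X * Polynomial.C (X 1),
    Polynomial.C (C b * X 0) + Polynomial.X * Polynomial.C (X 2)]

/-- The restriction of a polynomial to the line `x₂ = b x₀`, with `x₀` as the inner and `x₁` as
the outer variable. -/
noncomputable def rowRestriction {k : Type*} [Field k] (b : k) :
    MvPolynomial (Fin 3) k →ₐ[k] Polynomial (Polynomial k) :=
  aeval ![Polynomial.C Polynomial.X, Polynomial.X, Polynomial.C (Polynomial.C b * Polynomial.X)]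

/-- At `T = 0` the expansion becomes `f(x₀, a x₀, b x₀)`, which is the line restriction with `x₀` as
variable. -/
theorem X_dvd_pointExpansion_iff {k : Type*} [Field k] (a b : k) (f : MvPolynomial (Fin 3) k) :
    Polynomial.X ∣ pointExpansion a b f ↔ f ∈ pointIdeal ![1, a, b] := by
  have h1 : (Polynomial.aeval (X 0 : MvPolynomial (Fin 3) k)).comp (lineRestriction ![1, a, b]) =
      ((Polynomial.aeval (0 : MvPolynomial (Fin 3) k)).restrictScalars k).comp
        (pointExpansion a b) := by
    refine algHom_ext fun i => ?_
    fin_cases i <;> simp [lineRestriction, pointExpansion, algebraMap_eq]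
  have h2 : lineRestriction ![1, a, b] =
      ((aeval fun _ => Polynomial.X : MvPolynomial (Fin 3) k →ₐ[k] Polynomial k).comp
      (((Polynomial.aeval (0 : MvPolynomial (Fin 3) k)).restrictScalars k).comp
        (pointExpansion a b))) := by
    refine algHom_ext fun i => ?_
    fin_cases i <;> simp [lineRestriction, pointExpansion, - Polynomial.X_mul_C]
  have h3 : ((Polynomial.aeval (0 : MvPolynomial (Fin 3) k)).restrictScalars k)
      (pointExpansion a b f) = (pointExpansion a b f).coeff 0 := by
    rw [AlgHom.restrictScalars_apply, Polynomial.coeff_zero_eq_aeval_zero]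
  rw [Polynomial.X_dvd_iff, pointIdeal, RingHom.mem_ker, ← h3]
  constructor
  · intro h
    rw [h2, AlgHom.comp_apply, AlgHom.comp_apply, h, map_zero]
  · intro h
    have := DFunLike.congr_fun h1 f
    rw [AlgHom.comp_apply, h, map_zero] at this
    exact this.symm

theorem X_pow_dvd_pointExpansion_of_mem_pow {k : Type*} [Field k] (a b : k) {t : ℕ}
    {f : MvPolynomial (Fin 3) k} (hf : f ∈ pointIdeal ![1, a, b] ^ t) :
    Polynomial.X ^ t ∣ pointExpansion a b f := by
  have hle : pointIdeal ![1, a, b] ≤ (Ideal.span {Polynomial.X}).comap (pointExpansion a b) :=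
    fun g hg => Ideal.mem_span_singleton.2 ((X_dvd_pointExpansion_iff a b g).2 hg)
  have h := (Ideal.pow_right_mono hle t).trans (Ideal.le_comap_pow _ t) hf
  rwa [Ideal.mem_comap, Ideal.span_singleton_pow, Ideal.mem_span_singleton] at h

theorem X_pow_dvd_pointExpansion_of_mul {k : Type*} [Field k] (a b : k) {t : ℕ}
    {s f : MvPolynomial (Fin 3) k} (hs : s ∉ pointIdeal ![1, a, b])
    (h : Polynomial.X ^ t ∣ pointExpansion a b (s * f)) :
    Polynomial.X ^ t ∣ pointExpansion a b f := by
  rw [map_mul] at h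
  exact Polynomial.prime_X.pow_dvd_of_dvd_mul_left t
    (fun h' => hs ((X_dvd_pointExpansion_iff a b s).1 h')) h

/-- The linear form `x₂ - b x₀`. -/
noncomputable def rowForm {k : Type*} [Field k] (b : k) : MvPolynomial (Fin 3) k :=
  X 2 - C b * X 0

theorem isHomogeneous_rowForm {k : Type*} [Field k] (b : k) : (rowForm b).IsHomogeneous 1 :=
  (isHomogeneous_X k 2).sub (by simpa using (isHomogeneous_C (Fin 3) b).mul (isHomogeneous_X k 0))

theorem rowForm_ne_zero {k : Type*} [Field k] (b : k) : rowForm b ≠ 0 := by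
  intro h
  have := congrArg (eval ![0, 0, 1]) h
  simp [rowForm] at this

/-- The row form expands to `T x₂`, which has exactly one factor `T`. -/
theorem X_pow_dvd_pointExpansion_of_rowForm_mul {k : Type*} [Field k] (a b : k) {m : ℕ}
    {f : MvPolynomial (Fin 3) k} (h : Polynomial.X ^ m ∣ pointExpansion a b (rowForm b * f)) :
    Polynomial.X ^ (m - 1) ∣ pointExpansion a b f := by
  cases m with
  | zero => simp
  | succ m =>
    have hrow : pointExpansion a b (rowForm b) = Polynomial.X * Polynomial.C (X 2) := by
      simp [pointExpansion, rowForm, IsScalarTower.algebraMap_apply k (MvPolynomial (Fin 3) k)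
        (Polynomial (MvPolynomial (Fin 3) k)), algebraMap_eq]
    rw [map_mul, hrow, pow_succ', mul_assoc] at h
    have h' := (mul_dvd_mul_iff_left Polynomial.X_ne_zero).1 h
    refine Polynomial.prime_X.pow_dvd_of_dvd_mul_left m (fun hX => ?_) h'
    rw [Polynomial.X_dvd_iff, Polynomial.coeff_C_zero] at hX
    exact X_ne_zero 2 hX

theorem rowForm_notMem_pointIdeal {k : Type*} [Field k] (a : k) {b c : k} (h : b ≠ c) :
    rowForm c ∉ pointIdeal ![1, a, b] := by
  rw [mem_pointIdeal_of_isHomogeneous (isHomogeneous_rowForm c)]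
  simpa [rowForm, sub_eq_zero] using h

theorem rowForm_dvd_of_rowRestriction_eq_zero {k : Type*} [Field k] {b : k}
    {f : MvPolynomial (Fin 3) k} (h : rowRestriction b f = 0) : rowForm b ∣ f := by
  let q := Ideal.Quotient.mkₐ k (Ideal.span {rowForm b})
  let j : Polynomial (Polynomial k) →+* MvPolynomial (Fin 3) k :=
    Polynomial.eval₂RingHom (Polynomial.aeval (X 0 : MvPolynomial (Fin 3) k)).toRingHom (X 1)
  have hq : (q.toRingHom.comp j).comp (rowRestriction b).toRingHom = q.toRingHom := by
    refine ringHom_ext (fun r => ?_) fun i => ?_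
    · simp [j, rowRestriction, algebraMap_eq]
    · fin_cases i
      · simp [j, rowRestriction]
      · simp [j, rowRestriction]
      · have : q (C b * X 0) = q (X 2) :=
          (Ideal.Quotient.eq.2 (Ideal.mem_span_singleton_self (rowForm b))).symm
        simpa [j, rowRestriction, algebraMap_eq] using this
  have h' : q f = 0 := by
    have := DFunLike.congr_fun hq f
    rw [← AlgHom.coe_toRingHom, ← AlgHom.toRingHom_eq_coe, ← this]
    simp [h]
  exact Ideal.mem_span_singleton.1 (Ideal.Quotient.eq_zero_iff_mem.1 h')

/-- Substituting `T = x₁ - a x₀`, with `x₁ ↦ 1` and `x₂ ↦ 0` in the coefficients, turns the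
expansion into the restriction. -/
theorem X_sub_C_pow_dvd_rowRestriction {k : Type*} [Field k] {a b : k} {m : ℕ}
    {f : MvPolynomial (Fin 3) k} (h : Polynomial.X ^ m ∣ pointExpansion a b f) :
    (Polynomial.X - Polynomial.C (Polynomial.C a * Polynomial.X)) ^ m ∣ rowRestriction b f := by
  let e : Polynomial (MvPolynomial (Fin 3) k) →+* Polynomial (Polynomial k) :=
    Polynomial.eval₂RingHom
      (aeval ![Polynomial.C Polynomial.X, 1, 0] : _ →ₐ[k] Polynomial (Polynomial k)).toRingHom
      (Polynomial.X - Polynomial.C (Polynomial.C a * Polynomial.X))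
  have he : e.comp (pointExpansion a b).toRingHom = (rowRestriction b).toRingHom := by
    refine ringHom_ext (fun r => ?_) fun i => ?_
    · simp [e, pointExpansion, rowRestriction, IsScalarTower.algebraMap_apply k
        (MvPolynomial (Fin 3) k) (Polynomial (MvPolynomial (Fin 3) k)), algebraMap_eq]
    · fin_cases i <;>
        simp [e, pointExpansion, rowRestriction, IsScalarTower.algebraMap_apply k
        (Polynomial k) (Polynomial (Polynomial k))]
  have := map_dvd e h
  have hf := DFunLike.congr_fun he f
  rw [map_pow] at this
  simp only [e, Polynomial.coe_eval₂RingHom, Polynomial.eval₂_X] at this hf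
  exact hf ▸ this

theorem natDegree_rowRestriction_le {k : Type*} [Field k] (b : k) (f : MvPolynomial (Fin 3) k) :
    (rowRestriction b f).natDegree ≤ f.totalDegree := by
  rw [rowRestriction, ← aeval_map_algebraMap (Polynomial k)]
  refine (aeval_natDegree_le _ (Finset.sup_mono (support_map_subset _ f)) _ (n := 1) fun i => ?_).trans_eq
    (mul_one _)
  fin_cases i <;> simp [-map_mul]

theorem card_mul_le_natDegree {D : Type*} [CommRing D] [IsDomain D] {p : Polynomial D} (hp : p ≠ 0)
    (s : Finset D) {m : ℕ} (h : ∀ r ∈ s, (Polynomial.X - Polynomial.C r) ^ m ∣ p) :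
    s.card * m ≤ p.natDegree := by
  classical
  refine le_trans ?_ (Polynomial.card_roots' p)
  have hle : m • s.val ≤ p.roots := by
    refine Multiset.le_iff_count.2 fun r => ?_
    rw [Multiset.count_nsmul, Polynomial.count_roots]
    by_cases hr : r ∈ s
    · rw [Multiset.count_eq_one_of_mem s.nodup hr, mul_one]
      exact (Polynomial.le_rootMultiplicity_iff hp).2 (h r hr)
    · rw [Multiset.count_eq_zero_of_notMem hr, mul_zero]
      exact Nat.zero_le _
  have hcard := Multiset.card_le_card hle
  rwa [Multiset.card_nsmul, mul_comm, Finset.card_val] at hcard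

/-! ### The lower bound on degrees -/

/-- The nonzero restriction to the row has the roots `j x₀`, distinct in characteristic zero, each
of multiplicity at least `m`. -/
theorem mul_le_totalDegree_of_not_rowForm_dvd {k : Type*} [Field k] [CharZero k] {b : k} {m n : ℕ}
    {f : MvPolynomial (Fin 3) k} (hb : ¬ rowForm b ∣ f)
    (h : ∀ j < n, Polynomial.X ^ m ∣ pointExpansion (j : k) b f) :
    n * m ≤ f.totalDegree := by
  classical
  have hinj : Function.Injective fun j : ℕ =>
      (Polynomial.C (j : k) * Polynomial.X : Polynomial k) := fun i j hij =>
    Nat.cast_injective (Polynomial.C_injective (mul_right_cancel₀ Polynomial.X_ne_zero hij))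
  have := card_mul_le_natDegree (fun h0 => hb (rowForm_dvd_of_rowRestriction_eq_zero h0))
    ((Finset.range n).image fun j : ℕ => (Polynomial.C (j : k) * Polynomial.X : Polynomial k))
    (m := m) (by
      intro r hr
      obtain ⟨j, hj, rfl⟩ := Finset.mem_image.1 hr
      exact X_sub_C_pow_dvd_rowRestriction (h j (Finset.mem_range.1 hj)))
  rw [Finset.card_image_of_injective _ hinj, Finset.card_range] at this
  exact this.trans (natDegree_rowRestriction_le b f)

theorem le_totalDegree_of_X_pow_dvd_pointExpansion {k : Type*} [Field k] [CharZero k]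
    (f : MvPolynomial (Fin 3) k) (m : Fin 3 → ℕ) (hf : f ≠ 0)
    (h : ∀ b : Fin 3, ∀ j < 4 - (b : ℕ),
      Polynomial.X ^ m b ∣ pointExpansion (j : k) ((b : ℕ) : k) f) :
    6 * m 0 + 6 * m 1 + 5 * m 2 ≤ 6 * f.totalDegree := by
  induction hN : f.totalDegree using Nat.strong_induction_on generalizing f m with
  | _ N ih =>
    by_cases hdvd : ∃ b : Fin 3, rowForm ((b : ℕ) : k) ∣ f
    · obtain ⟨b, g, rfl⟩ := hdvd
      have hg : g ≠ 0 := right_ne_zero_of_mul hf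
      rw [totalDegree_mul_of_isDomain (rowForm_ne_zero _) hg,
        (isHomogeneous_rowForm _).totalDegree (rowForm_ne_zero _)] at hN
      -- Removing row `b` costs at most one order there and none on the other rows, which it does
      -- not meet at the points in question.
      have hm := ih _ (by omega) g (Function.update m b (m b - 1)) hg (fun c j hj => by
        by_cases hc : c = b
        · subst hc
          rw [Function.update_self]
          exact X_pow_dvd_pointExpansion_of_rowForm_mul _ _ (h c j hj)
        · rw [Function.update_of_ne hc]
          refine X_pow_dvd_pointExpansion_of_mul _ _ (rowForm_notMem_pointIdeal _ fun h' => hc ?_)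
            (h c j hj)
          exact Fin.ext (Nat.cast_injective h')) rfl
      fin_cases b <;> simp [Function.update] at hm <;> omega
    · have key := fun b : Fin 3 => mul_le_totalDegree_of_not_rowForm_dvd
        (fun h' => hdvd ⟨b, h'⟩) (h b)
      have h0 : 4 * m 0 ≤ f.totalDegree := key 0
      have h1 : 3 * m 1 ≤ f.totalDegree := key 1
      have h2 : 2 * m 2 ≤ f.totalDegree := key 2
      -- Add the three bounds with coefficients `3/2`, `2` and `5/2`, whose sum is 6.
      omega

/-! ### The nine points -/

/-- The affine coordinates of the points of the standard configuration of type `(2, 3, 4)`. -/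
def configurationPoint : Fin 9 → ℕ × ℕ :=
  ![(0, 2), (1, 2), (0, 1), (1, 1), (2, 1), (0, 0), (1, 0), (2, 0), (3, 0)]

theorem configurationPoint_injective : Function.Injective configurationPoint := by decide

theorem exists_configurationPoint_eq (b : Fin 3) (j : ℕ) (hj : j < 4 - (b : ℕ)) :
    ∃ i, configurationPoint i = (j, (b : ℕ)) := by
  have h : ∀ b : Fin 3, ∀ j : Fin 4, (j : ℕ) < 4 - (b : ℕ) →
    ∃ i, configurationPoint i = ((j : ℕ), (b : ℕ)) := by decide
  exact h b ⟨j, by omega⟩ hj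

theorem exists_eq_configurationPoint (i : Fin 9) :
    ∃ r : Fin 3, (configurationPoint i).1 < ![2, 3, 4] r ∧
      (configurationPoint i).2 = (r.rev : ℕ) := by
  revert i; decide

/-- Homogeneous coordinates of the points of the standard configuration of type `(2, 3, 4)`. -/
def configurationVector (k : Type*) [Field k] (i : Fin 9) : Fin 3 → k :=
  ![1, ((configurationPoint i).1 : k), ((configurationPoint i).2 : k)]

theorem projectiveVanishingIdeal_eq_iInf_configuration {k : Type*} [Field k]
    {X : Set (Projectivization k (Fin 3 → k))} (hX : IsStandardKConfiguration ![2, 3, 4] X) :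
    projectiveVanishingIdeal X = ⨅ i, pointIdeal (configurationVector k i) := by
  obtain ⟨-, -, rfl⟩ := hX
  rw [projectiveVanishingIdeal_eq_iInf]
  apply le_antisymm
  · refine le_iInf fun i => ?_
    obtain ⟨r, h1, h2⟩ := exists_eq_configurationPoint i
    refine (iInf_le _ ⟨_, r, _, h1, rfl⟩).trans_eq ?_
    refine (pointIdeal_rep_mk _ _).trans ?_
    rw [← h2]
    rfl
  · refine le_iInf fun p => ?_
    obtain ⟨p, r, j, hj, rfl⟩ := p
    have hj' : j < 4 - (r.rev : ℕ) := by
      fin_cases r <;> simpa using hj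
    obtain ⟨i, hi⟩ := exists_configurationPoint_eq r.rev j hj'
    refine (iInf_le _ i).trans_eq ?_
    refine Eq.trans ?_ (pointIdeal_rep_mk _ _).symm
    rw [configurationVector, hi]

theorem eq_of_pointIdeal_le {k : Type*} [Field k] {a b a' b' : k}
    (h : pointIdeal ![1, a, b] ≤ pointIdeal ![1, a', b']) : a = a' ∧ b = b' := by
  have key : ∀ (i : Fin 3) (c : k), eval ![1, a, b] (X i - C c * X 0) = 0 →
      eval ![1, a', b'] (X i - C c * X 0) = 0 := by
    intro i c h0
    have hom : (X i - C c * X 0 : MvPolynomial (Fin 3) k).IsHomogeneous 1 :=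
      (isHomogeneous_X k i).sub
        (by simpa using (isHomogeneous_C (Fin 3) c).mul (isHomogeneous_X k 0))
    exact (mem_pointIdeal_of_isHomogeneous hom).1
      (h ((mem_pointIdeal_of_isHomogeneous hom).2 h0))
  have h1 := key 1 a (by simp)
  have h2 := key 2 b (by simp)
  simp only [map_sub, map_mul, eval_X, eval_C, sub_eq_zero] at h1 h2
  exact ⟨by simpa using h1.symm, by simpa using h2.symm⟩

theorem eq_of_pointIdeal_configurationVector_le {k : Type*} [Field k] [CharZero k] (i j : Fin 9)
    (h : pointIdeal (configurationVector k j) ≤ pointIdeal (configurationVector k i)) : j = i := by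
  obtain ⟨h1, h2⟩ := eq_of_pointIdeal_le h
  exact configurationPoint_injective (Prod.ext (Nat.cast_injective h1) (Nat.cast_injective h2))

theorem mul_le_totalDegree_of_mem_symbolicPower {k : Type*} [Field k] [CharZero k] {t : ℕ}
    {f : MvPolynomial (Fin 3) k} (hf0 : f ≠ 0)
    (hf : f ∈ symbolicPower (⨅ i, pointIdeal (configurationVector k i)) t) :
    17 * t ≤ 6 * f.totalDegree := by
  have h := le_totalDegree_of_X_pow_dvd_pointExpansion f (fun _ => t) hf0 fun b j hj => by
    obtain ⟨i, hi⟩ := exists_configurationPoint_eq b j hj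
    rw [mem_symbolicPower_iff, associatedPrimes_quotient_iInf (fun i => pointIdeal_isPrime _)
      eq_of_pointIdeal_configurationVector_le] at hf
    obtain ⟨s, hs, hsf⟩ := hf _ ⟨i, rfl⟩
    have hle := Ideal.pow_right_mono (iInf_le (fun i => pointIdeal (configurationVector k i)) i) t
    have hv : configurationVector k i = ![1, (j : k), ((b : ℕ) : k)] := by
      rw [configurationVector, hi]
    simp only [hv] at hs hle
    exact X_pow_dvd_pointExpansion_of_mul _ _ hs (X_pow_dvd_pointExpansion_of_mem_pow _ _ (hle hsf))
  omega

/-! ### The extremal form of degree 17 -/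

/-- The irreducible factors of a form of degree `17` vanishing to order `6` at each point of the
standard configuration of type `(2, 3, 4)`: six lines and a conic. -/
noncomputable def extremalFactor (k : Type*) [Field k] : Fin 7 → MvPolynomial (Fin 3) k :=
  ![X 2, X 1, X 1 + X 2 - C 2 * X 0, X 1 - X 0, X 1 + X 2 - C 3 * X 0, X 2 - X 0,
    X 1 ^ 2 + X 1 * X 2 + X 2 ^ 2 - C 3 * X 0 * X 1 - C 3 * X 0 * X 2 + C 2 * X 0 ^ 2]

/-- The value of `extremalFactor` at the point `[1 : a : b]`. -/
def extremalFactorValue (a b : ℤ) : Fin 7 → ℤ :=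
  ![b, a, a + b - 2, a - 1, a + b - 3, b - 1, a ^ 2 + a * b + b ^ 2 - 3 * a - 3 * b + 2]

/-- The multiplicity of `extremalFactor` in the form of degree `17`. -/
def extremalMultiplicity : Fin 7 → ℕ := ![3, 3, 2, 2, 3, 2, 1]

/-- The degree of `extremalFactor`. -/
def extremalDegree : Fin 7 → ℕ := ![1, 1, 1, 1, 1, 1, 2]

/-- A form of degree `17` vanishing to order `6` at each point of the standard configuration of
type `(2, 3, 4)`. -/
noncomputable def extremalForm (k : Type*) [Field k] : MvPolynomial (Fin 3) k :=
  ∏ l, extremalFactor k l ^ extremalMultiplicity l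

theorem eval_extremalFactor {k : Type*} [Field k] (a b : ℤ) (l : Fin 7) :
    eval ![1, (a : k), (b : k)] (extremalFactor k l) = (extremalFactorValue a b l : k) := by
  fin_cases l <;> simp [extremalFactor, extremalFactorValue]

theorem isHomogeneous_extremalFactor {k : Type*} [Field k] (l : Fin 7) :
    (extremalFactor k l).IsHomogeneous (extremalDegree l) := by
  have hX := fun i : Fin 3 => isHomogeneous_X k i
  have hC := fun (c : k) {f : MvPolynomial (Fin 3) k} {n : ℕ} (hf : f.IsHomogeneous n) =>
    (hf.C_mul c)
  fin_cases l
  · exact hX 2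
  · exact hX 1
  · exact ((hX 1).add (hX 2)).sub (hC 2 (hX 0))
  · exact (hX 1).sub (hX 0)
  · exact ((hX 1).add (hX 2)).sub (hC 3 (hX 0))
  · exact (hX 2).sub (hX 0)
  · exact ((((((hX 1).pow 2).add ((hX 1).mul (hX 2))).add ((hX 2).pow 2)).sub
      ((hC 3 (hX 0)).mul (hX 1))).sub ((hC 3 (hX 0)).mul (hX 2))).add (hC 2 ((hX 0).pow 2))

theorem extremalForm_ne_zero {k : Type*} [Field k] [CharZero k] : extremalForm k ≠ 0 := by
  refine Finset.prod_ne_zero_iff.2 fun l _ => pow_ne_zero _ fun h => ?_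
  -- The point `[1 : 5 : 5]` lies on none of the seven curves.
  have hval : ∀ l, extremalFactorValue 5 5 l ≠ 0 := by decide
  have h5 := eval_extremalFactor (k := k) 5 5 l
  rw [h, map_zero, eq_comm, Int.cast_eq_zero] at h5
  exact hval l h5

theorem isHomogeneous_extremalForm {k : Type*} [Field k] : (extremalForm k).IsHomogeneous 17 := by
  have hdeg : ∑ l, extremalDegree l * extremalMultiplicity l = 17 := by decide
  rw [← hdeg]
  exact IsHomogeneous.prod Finset.univ _ _ fun l _ => (isHomogeneous_extremalFactor l).pow _

/-- Multiplicities of the factors through each point add up to at least 6. The conic is not needed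
at `(0,0)`, `(3,0)` and `(1,1)`, where the lines already contribute 6. -/
theorem extremalForm_mem_pow {k : Type*} [Field k] (i : Fin 9) :
    extremalForm k ∈ pointIdeal (configurationVector k i) ^ 6 := by
  have hval : ∀ i, 6 ≤ ∑ l, if extremalFactorValue (configurationPoint i).1
      (configurationPoint i).2 l = 0 then extremalMultiplicity l else 0 := by decide
  refine Ideal.pow_le_pow_right (hval i) ?_
  rw [← Finset.prod_pow_eq_pow_sum]
  refine Ideal.prod_mem_prod fun l _ => ?_
  split_ifs with h
  · refine Ideal.pow_mem_pow ((mem_pointIdeal_of_isHomogeneous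
      (isHomogeneous_extremalFactor l)).2 ?_) _
    have := eval_extremalFactor (k := k) (configurationPoint i).1 (configurationPoint i).2 l
    rw [h, Int.cast_zero, Int.cast_natCast, Int.cast_natCast] at this
    exact this
  · rw [pow_zero, Ideal.one_eq_top]
    trivial

/-- The exponent is `⌈t/6⌉`, the least `e` with `6e ≥ t`. -/
theorem extremalForm_pow_mem_symbolicPower {k : Type*} [Field k] [CharZero k] (t : ℕ) :
    extremalForm k ^ ((t + 5) / 6) ∈
      symbolicPower (⨅ i, pointIdeal (configurationVector k i)) t := by
  refine iInf_pow_le_symbolicPower_iInf (fun i => pointIdeal_isPrime _)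
    eq_of_pointIdeal_configurationVector_le t (Ideal.mem_iInf.2 fun i => ?_)
  have h := Ideal.pow_mem_pow (extremalForm_mem_pow (k := k) i) ((t + 5) / 6)
  rw [← pow_mul] at h
  exact Ideal.pow_le_pow_right (by omega) h

/-! ### Bounds on the initial degree and the limit -/

theorem initialDegree_symbolicPower_configuration_bounds {k : Type*} [Field k] [CharZero k]
    (t : ℕ) :
    17 * t ≤ 6 * initialDegree (symbolicPower (⨅ i, pointIdeal (configurationVector k i)) t) ∧
      initialDegree (symbolicPower (⨅ i, pointIdeal (configurationVector k i)) t) ≤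
        17 * ((t + 5) / 6) := by
  -- This also makes the set of degrees nonempty, so that `sInf` is attained and is not the default
  -- value 0.
  have hmem : 17 * ((t + 5) / 6) ∈ {d : ℕ | ∃ f : MvPolynomial (Fin 3) k,
      f ∈ symbolicPower (⨅ i, pointIdeal (configurationVector k i)) t ∧ f ≠ 0 ∧
        f.IsHomogeneous d} :=
    ⟨_, extremalForm_pow_mem_symbolicPower t, pow_ne_zero _ extremalForm_ne_zero,
      isHomogeneous_extremalForm.pow _⟩
  refine ⟨?_, Nat.sInf_le hmem⟩
  obtain ⟨f, hf, hf0, hd⟩ := Nat.sInf_mem ⟨_, hmem⟩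
  rw [initialDegree, ← hd.totalDegree hf0]
  exact mul_le_totalDegree_of_mem_symbolicPower hf0 hf

theorem tendsto_div_of_bounds {u : ℕ → ℕ} (h1 : ∀ t, 17 * t ≤ 6 * u t)
    (h2 : ∀ t, u t ≤ 17 * ((t + 5) / 6)) :
    Filter.Tendsto (fun t : ℕ => (u t : ℝ) / (t : ℝ)) Filter.atTop (nhds (17 / 6)) := by
  -- The error `85/6 = 17 · 5/6` comes from rounding `t/6` up.
  have hlim : Filter.Tendsto (fun t : ℕ => (17 / 6 : ℝ) + (85 / 6) / (t : ℝ)) Filter.atTop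
      (nhds (17 / 6)) := by
    simpa using (tendsto_const_div_atTop_nhds_zero_nat (85 / 6 : ℝ)).const_add (17 / 6 : ℝ)
  refine tendsto_of_tendsto_of_tendsto_of_le_of_le' tendsto_const_nhds hlim ?_ ?_
  · filter_upwards [Filter.eventually_gt_atTop 0] with t ht
    have h : (17 * t : ℝ) ≤ 6 * u t := by exact_mod_cast h1 t
    rw [le_div_iff₀ (by exact_mod_cast ht)]
    linarith
  · filter_upwards [Filter.eventually_gt_atTop 0] with t ht
    have h : (6 * u t : ℝ) ≤ 17 * (t + 5) := by
      have := h2 t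
      exact_mod_cast (by omega : 6 * u t ≤ 17 * (t + 5))
    have ht' : (0 : ℝ) < t := by exact_mod_cast ht
    rw [← sub_nonneg]
    have : (17 / 6 + 85 / 6 / (t : ℝ)) - u t / t = (17 * (t + 5) - 6 * u t) / (6 * t) := by
      field_simp
      ring
    rw [this]
    exact div_nonneg (by linarith) (by linarith)

theorem mainTheorem10 {k : Type*} [Field k] [IsAlgClosed k] [CharZero k]
    (X : Set (Projectivization k (Fin 3 → k)))
    (hX : IsStandardKConfiguration ![2, 3, 4] X) :
    HasWaldschmidtConstant (projectiveVanishingIdeal X) (17 / 6 : ℝ) := by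
  rw [projectiveVanishingIdeal_eq_iInf_configuration hX]
  exact tendsto_div_of_bounds (fun t => (initialDegree_symbolicPower_configuration_bounds t).1)
    fun t => (initialDegree_symbolicPower_configuration_bounds t).2
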